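/- Let $1<p<\infty$, $0<s<1$, and let $\Omega\subset\mathbb R^N$ be an open set. For a function $u$ on $\mathbb R^N$ write $$[u]_{s,p}=\Big(\iint_{\mathbb R^{2N}}\frac{|u(x)-u(y)|^p}{|x-y|^{N+sp}}\,dx\,dy\Big)^{1/p},$$ and let $\mathcal D_0^{s,p}(\Omega)$ be the completion of $C_0^\infty(\Omega)$ with respect to the norm $[\,\cdot\,]_{s,p}$. Suppose that the embedding $\mathcal D_0^{s,p}(\Omega)\hookrightarrow L^1(\Omega)$ (the continuous extension to the completion of the inclusion $C_0^\infty(\Omega)\subset L^1(\Omega)$) is well defined and compact; elements of $\mathcal D_0^{s,p}(\Omega)$ are then regarded as functions in $L^1(\Omega)$, extended by $0$ to $\mathbb R^N\setminus\Omega$. Let $w_{s,p,\Omega}$ be the $(s,p)$-torsion function of $\Omega$, i.e. the unique minimizer of $$\frac1p\,[u]_{s,p}^p-\int_\Omega u\,dx$$ over $u\in\mathcal D_0^{s,p}(\Omega)$. Then $$\int_\Omega\frac{|u|^p}{w_{s,p,\Omega}^{p-1}}\,dx\le\iint_{\mathbb R^{2N}}\frac{|u(x)-u(y)|^p}{|x-y|^{N+sp}}\,dx\,dy\qquad\text{for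 all }u\in\mathcal D_0^{s,p}(\Omega).$$ -/

import Mathlib

open MeasureTheory Set Filter Topology
open scoped ENNReal ContDiff

namespace FracTorsion

/-- The Euclidean `N`-space. -/
abbrev Space (N : ℕ) : Type := EuclideanSpace ℝ (Fin N)

/-- The range of the exponents: `0 < s < 1 < p < ⊤`. -/
structure Exponents (s p : ℝ) : Prop where
  s_pos : 0 < s
  s_lt_one : s < 1
  one_lt_p : 1 < p

/-- The double integral `∬ |u(x) - u(y)|^p / |x - y|^(N + s p) dx dy` over `ℝ^N × ℝ^N`,
as an element of `[0, ∞]`. -/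
noncomputable def gagliardoEnergy {N : ℕ} (s p : ℝ) (u : Space N → ℝ) : ℝ≥0∞ :=
  ∫⁻ z : Space N × Space N,
    ENNReal.ofReal (|u z.1 - u z.2| ^ p / ‖z.1 - z.2‖ ^ ((N : ℝ) + s * p))

/-- The Gagliardo norm `[u]_{s,p}`. -/
noncomputable def gagliardoNorm {N : ℕ} (s p : ℝ) (u : Space N → ℝ) : ℝ :=
  (gagliardoEnergy s p u).toReal ^ (1 / p)

/-- The vector space of smooth functions with compact support in `Ω`. -/
def smoothCompact {N : ℕ} (Ω : Set (Space N)) : Submodule ℝ (Space N → ℝ) where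
  carrier := {φ | ContDiff ℝ ∞ φ ∧ HasCompactSupport φ ∧ tsupport φ ⊆ Ω}
  zero_mem' := ⟨contDiff_const, HasCompactSupport.zero, by simp [tsupport]⟩
  add_mem' := fun {f g} hf hg => ⟨hf.1.add hg.1, hf.2.1.add hg.2.1,
    (tsupport_add f g).trans (union_subset hf.2.2 hg.2.2)⟩
  smul_mem' := fun c f hf => ⟨hf.1.const_smul c, hf.2.1.mono' ((Function.support_const_smul_subset c f).trans
      subset_closure), (closure_mono (Function.support_const_smul_subset c f)).trans hf.2.2⟩

section Helpers

variable {N : ℕ} {s p : ℝ}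

/-- The difference quotient whose `L^p(ℝ^N × ℝ^N)` norm is the Gagliardo norm. -/
noncomputable def diffQuot (s p : ℝ) (u : Space N → ℝ) (z : Space N × Space N) : ℝ :=
  (u z.1 - u z.2) / ‖z.1 - z.2‖ ^ (((N : ℝ) + s * p) / p)

theorem enorm_diffQuot_rpow (hp : 0 < p) (u : Space N → ℝ) (z : Space N × Space N) :
    ‖diffQuot s p u z‖ₑ ^ p
      = ENNReal.ofReal (|u z.1 - u z.2| ^ p / ‖z.1 - z.2‖ ^ ((N : ℝ) + s * p)) := by
  rw [← ofReal_norm, ENNReal.ofReal_rpow_of_nonneg (norm_nonneg _) hp.le]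
  congr 1
  have h0 : 0 ≤ ‖z.1 - z.2‖ ^ (((N : ℝ) + s * p) / p) := Real.rpow_nonneg (norm_nonneg _) _
  rw [diffQuot, norm_div, Real.div_rpow (norm_nonneg _) (norm_nonneg _), Real.norm_eq_abs,
    Real.norm_of_nonneg h0, ← Real.rpow_mul (norm_nonneg _), div_mul_cancel₀ _ hp.ne']

theorem eLpNorm_diffQuot (hp : 0 < p) (u : Space N → ℝ) :
    eLpNorm (diffQuot s p u) (ENNReal.ofReal p) volume = gagliardoEnergy s p u ^ (1 / p) := by
  rw [eLpNorm_eq_lintegral_rpow_enorm_toReal (by simpa using hp) ENNReal.ofReal_ne_top,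
    ENNReal.toReal_ofReal hp.le]
  simp only [enorm_diffQuot_rpow hp, gagliardoEnergy]

theorem gagliardoNorm_eq (hp : 0 < p) (u : Space N → ℝ) :
    gagliardoNorm s p u
      = (eLpNorm (diffQuot s p u) (ENNReal.ofReal p) volume).toReal := by
  rw [eLpNorm_diffQuot hp, gagliardoNorm, ENNReal.toReal_rpow]

theorem measurable_diffQuot {u : Space N → ℝ} (hu : Measurable u) :
    Measurable (diffQuot s p u) := by
  unfold diffQuot
  fun_prop

/-- Integrability of the radial majorant of the Gagliardo kernel. -/
theorem lintegral_kernel_lt_top (h : Exponents s p) (hN : N ≠ 0) {L M : ℝ} (hL : 0 ≤ L)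
    (hM : 0 ≤ M) :
    ∫⁻ x : Space N, ENNReal.ofReal (min (L * ‖x‖) M ^ p / ‖x‖ ^ ((N : ℝ) + s * p)) < ⊤ := by
  have hs := h.s_pos
  have hs1 := h.s_lt_one
  have hp := h.one_lt_p
  have hp0 : 0 < p := by linarith
  have : Nonempty (Fin N) := ⟨⟨0, Nat.pos_of_ne_zero hN⟩⟩
  have : Nontrivial (Space N) := inferInstance
  have key : Integrable (fun x : Space N =>
      (fun r : ℝ => min (L * r) M ^ p / r ^ ((N : ℝ) + s * p)) ‖x‖) volume := by
    rw [integrable_fun_norm_addHaar (volume : Measure (Space N))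
      (f := fun r : ℝ => min (L * r) M ^ p / r ^ ((N : ℝ) + s * p))]
    simp only [finrank_euclideanSpace, Fintype.card_fin, smul_eq_mul]
    have hmeas : Measurable fun r : ℝ =>
        r ^ (N - 1) * (min (L * r) M ^ p / r ^ ((N : ℝ) + s * p)) := by fun_prop
    have hpow : ∀ r : ℝ, 0 < r → r ^ (N - 1) / r ^ ((N : ℝ) + s * p) = r ^ (-1 - s * p) := by
      intro r hr
      rw [← Real.rpow_natCast, ← Real.rpow_sub hr, Nat.cast_pred (Nat.pos_of_ne_zero hN)]
      congr 1
      ring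
    rw [← Ioc_union_Ioi_eq_Ioi (zero_le_one' ℝ)]
    refine IntegrableOn.union ?_ ?_
    · have h1 : IntegrableOn (fun r : ℝ => L ^ p * r ^ (p - 1 - s * p)) (Ioc 0 1) := by
        have := (intervalIntegral.intervalIntegrable_rpow' (a := 0) (b := 1)
          (r := p - 1 - s * p) (by nlinarith))
        rw [intervalIntegrable_iff_integrableOn_Ioc_of_le zero_le_one] at this
        exact this.const_mul _
      refine h1.mono' hmeas.aestronglyMeasurable ?_
      filter_upwards [ae_restrict_mem measurableSet_Ioc] with r hr
      have hr0 : 0 < r := hr.1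
      have hm0 : 0 ≤ min (L * r) M := le_min (by positivity) hM
      rw [Real.norm_of_nonneg (by positivity), mul_div_left_comm, hpow r hr0]
      calc min (L * r) M ^ p * r ^ (-1 - s * p) ≤ (L * r) ^ p * r ^ (-1 - s * p) := by
            gcongr
            exact min_le_left _ _
        _ = L ^ p * r ^ (p - 1 - s * p) := by
            rw [Real.mul_rpow hL hr0.le, mul_assoc, ← Real.rpow_add hr0]
            congr 2
            ring
    · have h1 : IntegrableOn (fun r : ℝ => M ^ p * r ^ (-1 - s * p)) (Ioi 1) :=
        (integrableOn_Ioi_rpow_of_lt (by nlinarith) one_pos).const_mul _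
      refine h1.mono' hmeas.aestronglyMeasurable ?_
      filter_upwards [ae_restrict_mem measurableSet_Ioi] with r hr
      have hr0 : 0 < r := lt_trans one_pos hr
      have hm0 : 0 ≤ min (L * r) M := le_min (by positivity) hM
      rw [Real.norm_of_nonneg (by positivity), mul_div_left_comm, hpow r hr0]
      gcongr
      exact min_le_right _ _
  exact key.lintegral_lt_top

/-- A smooth compactly supported function has finite Gagliardo energy. -/
theorem gagliardoEnergy_lt_top (h : Exponents s p) {u : Space N → ℝ} (hu : ContDiff ℝ ∞ u)
    (hc : HasCompactSupport u) : gagliardoEnergy s p u < ⊤ := by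
  have hp0 : 0 < p := by linarith [h.one_lt_p]
  rcases eq_or_ne N 0 with rfl | hN
  · have h0 : gagliardoEnergy s p u = 0 := by
      have : ∀ z : Space 0 × Space 0, ENNReal.ofReal
          (|u z.1 - u z.2| ^ p / ‖z.1 - z.2‖ ^ (((0 : ℕ) : ℝ) + s * p)) = 0 := by
        intro z
        rw [Subsingleton.elim z.1 z.2]
        simp [Real.zero_rpow hp0.ne']
      simp only [gagliardoEnergy, this, lintegral_zero]
    rw [h0]
    exact ENNReal.zero_lt_top
  obtain ⟨L, hL⟩ := hu.lipschitzWith_of_hasCompactSupport hc (by simp)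
  obtain ⟨M, hM⟩ := hc.exists_bound_of_continuous hu.continuous
  have hM0 : 0 ≤ M := (norm_nonneg _).trans (hM 0)
  set k : Space N → ℝ≥0∞ := fun x =>
    ENNReal.ofReal (min (L * ‖x‖) (2 * M) ^ p / ‖x‖ ^ ((N : ℝ) + s * p)) with hk
  have hkm : Measurable k := by
    rw [hk]
    fun_prop
  have hkfin : ∫⁻ x, k x < ⊤ := lintegral_kernel_lt_top h hN L.2 (by positivity)
  set K := tsupport u with hK
  have hKm : MeasurableSet K := (isClosed_tsupport u).measurableSet
  have hKfin : volume K < ⊤ := hc.isCompact.measure_lt_top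
  set c : Space N → ℝ≥0∞ := K.indicator 1 with hcdef
  have hcm : Measurable c := measurable_one.indicator hKm
  have hcint : ∫⁻ x, c x = volume K := by
    rw [hcdef, lintegral_indicator_one hKm]
  have hbound : ∀ z : Space N × Space N,
      ENNReal.ofReal (|u z.1 - u z.2| ^ p / ‖z.1 - z.2‖ ^ ((N : ℝ) + s * p))
        ≤ c z.1 * k (z.1 - z.2) + c z.2 * k (z.1 - z.2) := by
    intro z
    have hle : ENNReal.ofReal (|u z.1 - u z.2| ^ p / ‖z.1 - z.2‖ ^ ((N : ℝ) + s * p))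
        ≤ k (z.1 - z.2) := by
      refine ENNReal.ofReal_le_ofReal ?_
      have h1 : |u z.1 - u z.2| ≤ min (L * ‖z.1 - z.2‖) (2 * M) := by
        refine le_min ?_ ?_
        · have := hL.dist_le_mul z.1 z.2
          rwa [Real.dist_eq, dist_eq_norm] at this
        · have ha := hM z.1
          have hb := hM z.2
          rw [Real.norm_eq_abs] at ha hb
          have := abs_sub (u z.1) (u z.2)
          linarith
      gcongr
    by_cases hx : z.1 ∈ K
    · refine hle.trans (le_add_right ?_)
      simp [hcdef, hx]
    by_cases hy : z.2 ∈ K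
    · refine hle.trans (le_add_left ?_)
      simp [hcdef, hy]
    · rw [image_eq_zero_of_notMem_tsupport hx, image_eq_zero_of_notMem_tsupport hy]
      simp [Real.zero_rpow hp0.ne']
  have hA : Measurable fun z : Space N × Space N => c z.1 * k (z.1 - z.2) := by fun_prop
  have hB : Measurable fun z : Space N × Space N => c z.2 * k (z.1 - z.2) := by fun_prop
  have hIA : ∫⁻ z : Space N × Space N, c z.1 * k (z.1 - z.2) = volume K * ∫⁻ x, k x := by
    rw [Measure.volume_eq_prod, lintegral_prod _ hA.aemeasurable]
    simp only
    have : ∀ x : Space N, ∫⁻ y, c x * k (x - y) = c x * ∫⁻ y, k y := by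
      intro x
      rw [lintegral_const_mul _ (by fun_prop), lintegral_sub_left_eq_self k x]
    simp only [this]
    rw [lintegral_mul_const _ hcm, hcint]
  have hIB : ∫⁻ z : Space N × Space N, c z.2 * k (z.1 - z.2) = volume K * ∫⁻ x, k x := by
    rw [Measure.volume_eq_prod, lintegral_prod_symm _ hB.aemeasurable]
    simp only
    have : ∀ y : Space N, ∫⁻ x, c y * k (x - y) = c y * ∫⁻ x, k x := by
      intro y
      rw [lintegral_const_mul _ (by fun_prop), lintegral_sub_right_eq_self k y]
    simp only [this]
    rw [lintegral_mul_const _ hcm, hcint]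
  calc gagliardoEnergy s p u
      ≤ ∫⁻ z : Space N × Space N, (c z.1 * k (z.1 - z.2) + c z.2 * k (z.1 - z.2)) :=
        lintegral_mono hbound
    _ = volume K * (∫⁻ x, k x) + volume K * ∫⁻ x, k x := by
        rw [lintegral_add_left hA, hIA, hIB]
    _ < ⊤ := by
        have := ENNReal.mul_lt_top hKfin hkfin
        exact ENNReal.add_lt_top.2 ⟨this, this⟩

theorem memLp_diffQuot (h : Exponents s p) {u : Space N → ℝ} (hu : ContDiff ℝ ∞ u)
    (hc : HasCompactSupport u) : MemLp (diffQuot s p u) (ENNReal.ofReal p) volume := by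
  have hp0 : 0 < p := by linarith [h.one_lt_p]
  refine ⟨(measurable_diffQuot hu.continuous.measurable).aestronglyMeasurable, ?_⟩
  rw [eLpNorm_diffQuot hp0]
  exact ENNReal.rpow_lt_top_of_nonneg (by positivity) (gagliardoEnergy_lt_top h hu hc).ne

end Helpers

variable {N : ℕ} {s p : ℝ}

/-- The space `C_0^∞(Ω)`, to be equipped with the Gagliardo norm `[·]_{s,p}`. -/
def TestSpace (_h : Exponents s p) (Ω : Set (Space N)) : Type :=
  smoothCompact Ω

namespace TestSpace

variable (h : Exponents s p) (Ω : Set (Space N))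

noncomputable instance : AddCommGroup (TestSpace h Ω) :=
  inferInstanceAs (AddCommGroup (smoothCompact Ω))

noncomputable instance : Module ℝ (TestSpace h Ω) :=
  inferInstanceAs (Module ℝ (smoothCompact Ω))

variable {h Ω}

/-- The underlying function of a test function. -/
def fn (φ : TestSpace h Ω) : Space N → ℝ := φ.1

theorem memLp_quot (φ : TestSpace h Ω) :
    MemLp (diffQuot s p φ.fn) (ENNReal.ofReal p) volume :=
  memLp_diffQuot h φ.2.1 φ.2.2.1

theorem memLp_one (φ : TestSpace h Ω) : MemLp φ.fn 1 (volume.restrict Ω) :=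
  memLp_one_iff_integrable.2
    ((φ.2.1.continuous.integrable_of_hasCompactSupport φ.2.2.1).restrict)

/-- The Gagliardo norm on `C_0^∞(Ω)`, with the proof that it is a seminorm. -/
noncomputable def gagliardoSeminorm (h : Exponents s p) (Ω : Set (Space N)) :
    AddGroupSeminorm (TestSpace h Ω) where
  toFun φ := gagliardoNorm s p φ.fn
  map_zero' := by
    have hp0 : 0 < p := by linarith [h.one_lt_p]
    have : diffQuot s p (fn (0 : TestSpace h Ω)) = 0 := by
      funext z
      change ((0 : ℝ) - 0) / _ = 0
      simp
    rw [gagliardoNorm_eq hp0, this]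
    simp
  add_le' := fun φ ψ => by
    have hp0 : 0 < p := by linarith [h.one_lt_p]
    have : diffQuot s p (fn (φ + ψ)) = diffQuot s p φ.fn + diffQuot s p ψ.fn := by
      funext z
      change (φ.fn z.1 + ψ.fn z.1 - (φ.fn z.2 + ψ.fn z.2)) / _
        = (φ.fn z.1 - φ.fn z.2) / _ + (ψ.fn z.1 - ψ.fn z.2) / _
      ring
    simp only [gagliardoNorm_eq hp0]
    rw [this, ← ENNReal.toReal_add φ.memLp_quot.eLpNorm_ne_top ψ.memLp_quot.eLpNorm_ne_top]
    refine ENNReal.toReal_mono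
      (ENNReal.add_ne_top.2 ⟨φ.memLp_quot.eLpNorm_ne_top, ψ.memLp_quot.eLpNorm_ne_top⟩) ?_
    refine eLpNorm_add_le φ.memLp_quot.1 ψ.memLp_quot.1 ?_
    simpa using h.one_lt_p.le
  neg' := fun φ => by
    have hp0 : 0 < p := by linarith [h.one_lt_p]
    have : diffQuot s p (fn (-φ)) = -diffQuot s p φ.fn := by
      funext z
      change (-φ.fn z.1 - -φ.fn z.2) / _ = -((φ.fn z.1 - φ.fn z.2) / _)
      ring
    simp only [gagliardoNorm_eq hp0]
    rw [this, eLpNorm_neg]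

noncomputable instance : SeminormedAddCommGroup (TestSpace h Ω) :=
  (gagliardoSeminorm h Ω).toSeminormedAddCommGroup

theorem norm_def (φ : TestSpace h Ω) : ‖φ‖ = gagliardoNorm s p φ.fn := rfl

noncomputable instance : NormedSpace ℝ (TestSpace h Ω) where
  norm_smul_le := fun c φ => by
    have hp0 : 0 < p := by linarith [h.one_lt_p]
    have : diffQuot s p (fn (c • φ)) = c • diffQuot s p φ.fn := by
      funext z
      change (c * φ.fn z.1 - c * φ.fn z.2) / _ = c * ((φ.fn z.1 - φ.fn z.2) / _)
      ring
    simp only [norm_def, gagliardoNorm_eq hp0]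
    rw [this, eLpNorm_const_smul, ENNReal.toReal_mul]
    simp

/-- The inclusion of `C_0^∞(Ω)` in `L^1(Ω)`. -/
noncomputable def toL1 : TestSpace h Ω →ₗ[ℝ] Lp ℝ 1 (volume.restrict Ω) where
  toFun φ := φ.memLp_one.toLp φ.fn
  map_add' := fun _ _ => rfl
  map_smul' := fun _ _ => rfl

end TestSpace

/-- The homogeneous fractional Sobolev space `D_0^{s,p}(Ω)`: the completion of `C_0^∞(Ω)` with
respect to the Gagliardo norm. Its norm is the extension of `[·]_{s,p}`. -/
abbrev HomSobolev (h : Exponents s p) (Ω : Set (Space N)) : Type :=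
  UniformSpace.Completion (TestSpace h Ω)

/-- The map `D_0^{s,p}(Ω) → L^1(Ω)`: the continuous extension of the inclusion of `C_0^∞(Ω)`. It is
meaningful if that inclusion is continuous for the Gagliardo norm. -/
noncomputable def embedL1 (h : Exponents s p) (Ω : Set (Space N)) :
    HomSobolev h Ω → Lp ℝ 1 (volume.restrict Ω) :=
  UniformSpace.Completion.extension (TestSpace.toL1 (h := h) (Ω := Ω))

/-- The embedding of `D_0^{s,p}(Ω)` into `L^1(Ω)` is (well defined, continuous and) compact. -/
def CompactlyEmbedsL1 (h : Exponents s p) (Ω : Set (Space N)) : Prop :=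
  Continuous (TestSpace.toL1 (h := h) (Ω := Ω)) ∧ IsCompactOperator (embedL1 h Ω)

/-- The function on `ℝ^N` given by an element of `D_0^{s,p}(Ω)` via the embedding into `L^1(Ω)`; it
vanishes outside `Ω`. -/
noncomputable def toFunction {h : Exponents s p} {Ω : Set (Space N)} (u : HomSobolev h Ω) :
    Space N → ℝ :=
  Ω.indicator (embedL1 h Ω u)

/-- The functional `(1/p) [u]_{s,p}^p - ∫_Ω u dx` on `D_0^{s,p}(Ω)`. -/
noncomputable def torsionFunctional {h : Exponents s p} {Ω : Set (Space N)}
    (u : HomSobolev h Ω) : ℝ :=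
  1 / p * ‖u‖ ^ p - ∫ x in Ω, toFunction u x

/-- The `(s,p)`-torsion function `w_{s,p,Ω}`: the minimizer of `torsionFunctional` on
`D_0^{s,p}(Ω)`, which exists and is unique if the embedding into `L^1(Ω)` is compact. -/
noncomputable def torsionFunction (h : Exponents s p) (Ω : Set (Space N)) : HomSobolev h Ω :=
  Classical.epsilon fun w => ∀ v : HomSobolev h Ω, torsionFunctional w ≤ torsionFunctional v

end FracTorsion

/-!
The inequality follows from a hidden convexity of the Gagliardo energy, and needs no Euler-Lagrange
equation. Let `σ(a, b) = (|a| ^ p + |b| ^ p) ^ (1 / p)` be the `ℓ^p` norm of a pair (`lpPair`). The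
reverse triangle inequality `|σ(a, b) - σ(a', b')| ^ p ≤ |a - a'| ^ p + |b - b'| ^ p`, applied to
the values of a pair of functions at `x` and at `y`, shows that the energy of `σ(w, u)` is at most
the sum of the energies of `w` and `u` (`gagliardoEnergy_lpPair_le`).

Let `w` be the torsion function. Comparing `w` with `σ(w, c u)` for `c > 0`, its minimality gives
`∫ σ(w, c u) ≤ ∫ w + c ^ p ‖u‖ ^ p / p` (`integral_lpPair_torsionFunction_le`); the case `u = 0` is
`∫ |w| ≤ ∫ w`, so `w ≥ 0`. With `σ = σ(w, c u)`, Young's inequality bounds `(c |u|) ^ p` by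
`p (σ - w) σ ^ (p - 1)`, and therefore `∫ |u| ^ p / σ ^ (p - 1) ≤ ‖u‖ ^ p`
(`lintegral_div_lpPair_le`). As `c` tends to `0`, Fatou's lemma yields the claim. This is valid also
where `w` vanishes: since `a / 0 = ∞` in `[0, ∞]` for `a ≠ 0`, the limit contains the information
that `u` vanishes almost everywhere on `{w = 0}`.

It is not necessary to know that `σ(w, c u)` belongs to `D_0^{s,p}(Ω)`. The comparison is made for
`σ(φ, ψ)` with test functions `φ` and `ψ`: this function is continuous with compact support in `Ω`,
and a mollification of it is a test function with the same integral and, by Jensen's inequality, no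
larger energy (`exists_testSpace_energy_le`). The resulting inequality extends to the completion by
density.

Two facts link this with the definitions. The torsion function is a minimizer
(`torsionFunctional_torsionFunction_le`): minimizing sequences are Cauchy because of a quantitative
strict convexity of `|·| ^ p` (`exists_abs_sub_rpow_le`). And the norm of `D_0^{s,p}(Ω)` is bounded
by the energy of the representing function (`ofReal_norm_rpow_le_gagliardoEnergy`).
-/

namespace FracTorsion

/-! ### Real inequalities -/

theorem abs_midpoint_rpow_lt {p : ℝ} (hp : 1 < p) {a b : ℝ} (hab : a ≠ b) :
    |(a + b) / 2| ^ p < (|a| ^ p + |b| ^ p) / 2 := by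
  have hp0 : 0 < p := by linarith
  by_cases h : |a| = |b|
  · have hba : b = -a := by
      rcases abs_eq_abs.1 h with h | h
      · exact absurd h hab
      · linarith
    have ha : 0 < |a| := by
      refine abs_pos.2 fun h0 => hab ?_
      rw [hba, h0, neg_zero]
    rw [← h, hba, add_neg_cancel, zero_div, abs_zero, Real.zero_rpow hp0.ne']
    positivity
  · have h1 := (strictConvexOn_rpow hp).2 (abs_nonneg a) (abs_nonneg b) h
      (by norm_num : (0 : ℝ) < 1 / 2) (by norm_num : (0 : ℝ) < 1 / 2) (by norm_num)
    simp only [smul_eq_mul] at h1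
    have h2 : |(a + b) / 2| ≤ 1 / 2 * |a| + 1 / 2 * |b| := by
      rw [abs_div, abs_two]
      linarith [abs_add_le a b]
    calc |(a + b) / 2| ^ p ≤ (1 / 2 * |a| + 1 / 2 * |b|) ^ p := by gcongr
      _ < _ := h1
      _ = _ := by ring

theorem abs_midpoint_rpow_le {p : ℝ} (hp : 1 < p) (a b : ℝ) :
    |(a + b) / 2| ^ p ≤ (|a| ^ p + |b| ^ p) / 2 := by
  rcases eq_or_ne a b with rfl | h
  · rw [add_self_div_two, add_self_div_two]
  · exact (abs_midpoint_rpow_lt hp h).le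

/-- A quantitative form of the strict convexity of `|·| ^ p`. Integrated, it does the work of the
uniform convexity of `L^p` for all exponents `p > 1` at once. -/
theorem exists_abs_sub_rpow_le {p : ℝ} (hp : 1 < p) {ε : ℝ} (hε : 0 < ε) :
    ∃ C : ℝ, 0 ≤ C ∧ ∀ a b : ℝ, |a - b| ^ p ≤
      ε * (|a| ^ p + |b| ^ p) + C * ((|a| ^ p + |b| ^ p) / 2 - |(a + b) / 2| ^ p) := by
  have hp0 : 0 < p := by linarith
  -- By homogeneity it is enough to bound the gap below on the compact set `S`.
  set S : Set (ℝ × ℝ) := {z | |z.1| ^ p + |z.2| ^ p = 1 ∧ ε ≤ |z.1 - z.2| ^ p} with hS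
  set G : ℝ × ℝ → ℝ := fun z => (|z.1| ^ p + |z.2| ^ p) / 2 - |(z.1 + z.2) / 2| ^ p with hG
  have hcont : ∀ f : ℝ × ℝ → ℝ, Continuous f → Continuous fun z => |f z| ^ p := fun f hf =>
    hf.abs.rpow_const fun _ => Or.inr hp0.le
  have c1 := hcont _ continuous_fst
  have c2 := hcont _ continuous_snd
  have c3 := hcont _ (continuous_fst.sub continuous_snd)
  have c4 := hcont _ ((continuous_fst.add continuous_snd).div_const (2 : ℝ))
  have hGc : Continuous G := ((c1.add c2).div_const 2).sub c4
  have hle1 : ∀ {x y : ℝ}, |x| ^ p + |y| ^ p = 1 → |x| ≤ 1 := by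
    intro x y hxy
    have hx : |x| ^ p ≤ 1 := by
      have : 0 ≤ |y| ^ p := by positivity
      linarith
    by_contra! hlt
    exact absurd hx (not_le.2 (Real.one_lt_rpow hlt hp0))
  have hScomp : IsCompact S := by
    refine Metric.isCompact_of_isClosed_isBounded ?_ ?_
    · exact (isClosed_eq (c1.add c2) continuous_const).inter (isClosed_le continuous_const c3)
    · refine (Metric.isBounded_closedBall (x := (0 : ℝ × ℝ)) (r := 1)).subset fun z hz => ?_
      rw [mem_closedBall_zero_iff, Prod.norm_def]
      exact max_le (hle1 hz.1) (hle1 (by rw [add_comm]; exact hz.1))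
  have hGpos : ∀ z ∈ S, 0 < G z := by
    intro z hz
    refine sub_pos.2 (abs_midpoint_rpow_lt hp fun hzz => ?_)
    have h2 := hz.2
    rw [hzz, sub_self, abs_zero, Real.zero_rpow hp0.ne'] at h2
    linarith
  obtain ⟨c, hc, hcG⟩ : ∃ c : ℝ, 0 < c ∧ ∀ z ∈ S, c ≤ G z := by
    rcases S.eq_empty_or_nonempty with he | hne
    · exact ⟨1, one_pos, by simp [he]⟩
    · obtain ⟨z, hz, hmin⟩ := hScomp.exists_isMinOn hne hGc.continuousOn
      exact ⟨G z, hGpos z hz, fun y hy => hmin hy⟩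
  refine ⟨2 ^ p / c, by positivity, ?_⟩
  have hunit : ∀ a b : ℝ, |a| ^ p + |b| ^ p = 1 → |a - b| ^ p ≤ ε + 2 ^ p / c * G (a, b) := by
    intro a b hab
    have hG0 : 0 ≤ G (a, b) := sub_nonneg.2 (abs_midpoint_rpow_le hp a b)
    rcases le_total ε (|a - b| ^ p) with h | h
    · have h1 : |a - b| ≤ 2 := by
        have := abs_sub a b
        linarith [hle1 hab, hle1 ((add_comm _ _).trans hab)]
      have h2 : |a - b| ^ p ≤ 2 ^ p := by gcongr
      have h3 : c ≤ G (a, b) := hcG (a, b) ⟨hab, h⟩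
      calc |a - b| ^ p ≤ 2 ^ p := h2
        _ = 2 ^ p / c * c := by field_simp
        _ ≤ 2 ^ p / c * G (a, b) := by gcongr
        _ ≤ _ := by linarith
    · have : 0 ≤ 2 ^ p / c * G (a, b) := by positivity
      linarith
  intro a b
  rcases (show 0 ≤ |a| ^ p + |b| ^ p by positivity).eq_or_lt with h0 | hpos
  · have ha : |a| ^ p = 0 := by
      linarith [show 0 ≤ |a| ^ p by positivity, show 0 ≤ |b| ^ p by positivity]
    have hb : |b| ^ p = 0 := by linarith
    rw [Real.rpow_eq_zero (abs_nonneg _) hp0.ne', abs_eq_zero] at ha hb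
    simp [ha, hb, Real.zero_rpow hp0.ne']
  · set m := |a| ^ p + |b| ^ p with hm
    set r := m ^ (1 / p) with hr
    have hr0 : 0 < r := Real.rpow_pos_of_pos hpos _
    have hrp : r ^ p = m := by
      rw [hr, ← Real.rpow_mul hpos.le, one_div_mul_cancel hp0.ne', Real.rpow_one]
    have hscale : ∀ x : ℝ, |x / r| ^ p = |x| ^ p / m := fun x => by
      rw [abs_div, abs_of_pos hr0, Real.div_rpow (abs_nonneg _) hr0.le, hrp]
    have h := hunit (a / r) (b / r) (by rw [hscale, hscale, ← add_div, div_self hpos.ne'])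
    simp only [hG] at h
    rw [← sub_div, ← add_div, div_right_comm, hscale, hscale, hscale, hscale, ← add_div, ← hm,
      div_self hpos.ne', div_le_iff₀ hpos] at h
    refine h.trans (le_of_eq ?_)
    field_simp

/-- The `ℓ^p` norm of the pair `(a, b)`. -/
noncomputable def lpPair (p a b : ℝ) : ℝ := (|a| ^ p + |b| ^ p) ^ (1 / p)

section lpPair

variable {p : ℝ}

theorem lpPair_nonneg (a b : ℝ) : 0 ≤ lpPair p a b := by
  unfold lpPair
  positivity

theorem lpPair_zero_right (hp : 0 < p) (a : ℝ) : lpPair p a 0 = |a| := by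
  rw [lpPair, abs_zero, Real.zero_rpow hp.ne', add_zero, ← Real.rpow_mul (abs_nonneg _),
    mul_one_div_cancel hp.ne', Real.rpow_one]

theorem lpPair_zero_zero (hp : 0 < p) : lpPair p 0 0 = 0 := by
  rw [lpPair_zero_right hp, abs_zero]

theorem lpPair_rpow (hp : 0 < p) (a b : ℝ) : lpPair p a b ^ p = |a| ^ p + |b| ^ p := by
  rw [lpPair, ← Real.rpow_mul (by positivity), one_div_mul_cancel hp.ne', Real.rpow_one]

theorem continuous_lpPair (hp : 0 < p) : Continuous fun z : ℝ × ℝ => lpPair p z.1 z.2 := by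
  have h1 : Continuous fun z : ℝ × ℝ => |z.1| ^ p :=
    continuous_fst.abs.rpow_const fun _ => Or.inr hp.le
  have h2 : Continuous fun z : ℝ × ℝ => |z.2| ^ p :=
    continuous_snd.abs.rpow_const fun _ => Or.inr hp.le
  exact (h1.add h2).rpow_const fun _ => Or.inr (by positivity)

/-- The reverse triangle inequality in `ℓ^p`. -/
theorem abs_lpPair_sub_le (hp : 1 ≤ p) (a b a' b' : ℝ) :
    |lpPair p a b - lpPair p a' b'| ≤ lpPair p (a - a') (b - b') := by
  have : Fact (1 ≤ ENNReal.ofReal p) := ⟨by simpa using hp⟩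
  have hpr : (ENNReal.ofReal p).toReal = p := ENNReal.toReal_ofReal (by linarith)
  have key : ∀ x y : ℝ, ‖WithLp.toLp (ENNReal.ofReal p) (x, y)‖ = lpPair p x y := by
    intro x y
    rw [WithLp.prod_norm_eq_add (by rw [hpr]; linarith), hpr]
    rfl
  rw [← key, ← key, ← key]
  exact abs_norm_sub_norm_le _ _

theorem abs_le_lpPair (hp : 0 < p) (a b : ℝ) : |a| ≤ lpPair p a b := by
  rw [← Real.rpow_le_rpow_iff (abs_nonneg a) (lpPair_nonneg a b) hp, lpPair_rpow hp]
  linarith [show 0 ≤ |b| ^ p by positivity]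

theorem lpPair_le (hp : 1 ≤ p) (a b : ℝ) : lpPair p a b ≤ |a| + |b| := by
  have hp0 : 0 < p := by linarith
  have h := (abs_le.1 (abs_lpPair_sub_le hp a b a 0)).2
  have h0 : lpPair p (a - a) (b - 0) = |b| := by
    rw [sub_self, sub_zero, lpPair, abs_zero, Real.zero_rpow hp0.ne', zero_add,
      ← Real.rpow_mul (abs_nonneg _), mul_one_div_cancel hp0.ne', Real.rpow_one]
  rw [h0, lpPair_zero_right hp0] at h
  linarith

/-- The increment of the curve `b ↦ ‖(a, b)‖_p` controls `|b| ^ p`; this is Young's inequality for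
`|a|` and `lpPair p a b ^ (p - 1)`. -/
theorem abs_rpow_le_lpPair_sub (hp : 1 < p) (a b : ℝ) :
    |b| ^ p ≤ p * (lpPair p a b - |a|) * lpPair p a b ^ (p - 1) := by
  have hp0 : 0 < p := by linarith
  have hp1 : p - 1 ≠ 0 := by linarith
  set σ := lpPair p a b with hσ
  have hσ0 : 0 ≤ σ := lpPair_nonneg a b
  have hσp : σ ^ p = |a| ^ p + |b| ^ p := lpPair_rpow hp0 a b
  have hy := Real.young_inequality_of_nonneg (abs_nonneg a)
    (show 0 ≤ σ ^ (p - 1) by positivity) (Real.HolderConjugate.conjExponent hp)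
  rw [Real.conjExponent, ← Real.rpow_mul hσ0, mul_div_cancel₀ p hp1] at hy
  have hmul : σ * σ ^ (p - 1) = σ ^ p := by
    rw [mul_comm, ← Real.rpow_add_one' hσ0 (by linarith), sub_add_cancel]
  have hy2 : p * (|a| * σ ^ (p - 1)) ≤ |a| ^ p + (p - 1) * σ ^ p := by
    calc p * (|a| * σ ^ (p - 1)) ≤ p * (|a| ^ p / p + σ ^ p / (p / (p - 1))) := by gcongr
      _ = _ := by field_simp
  calc |b| ^ p = σ ^ p - |a| ^ p := by rw [hσp]; ring
    _ ≤ p * (σ * σ ^ (p - 1)) - p * (|a| * σ ^ (p - 1)) := by rw [hmul]; linarith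
    _ = _ := by ring

end lpPair

/-! ### Mollification does not increase the Gagliardo energy -/

theorem gagliardoEnergy_eq_lintegral_enorm {N : ℕ} {s p : ℝ} (hp : 0 < p) (u : Space N → ℝ) :
    gagliardoEnergy s p u = ∫⁻ z, ‖diffQuot s p u z‖ₑ ^ p := by
  simp only [enorm_diffQuot_rpow hp, gagliardoEnergy]

/-- Jensen's inequality for `|·| ^ p` and the probability density `ρ`. -/
theorem enorm_integral_smul_rpow_le {α : Type*} [MeasurableSpace α] {μ : Measure α} {p : ℝ}
    (hp : 1 ≤ p) {ρ d : α → ℝ} (hρ : Measurable ρ) (hρ0 : ∀ x, 0 ≤ ρ x) (hρi : Integrable ρ μ)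
    (hρ1 : ∫ x, ρ x ∂μ = 1) (hd : Measurable d) :
    ‖∫ x, ρ x • d x ∂μ‖ₑ ^ p ≤ ∫⁻ x, ENNReal.ofReal (ρ x) * ‖d x‖ₑ ^ p ∂μ := by
  have hp0 : 0 < p := by linarith
  set ν : Measure α := μ.withDensity fun x => ENNReal.ofReal (ρ x) with hν
  have hint : ∀ g : α → ℝ≥0∞, Measurable g →
      ∫⁻ x, g x ∂ν = ∫⁻ x, ENNReal.ofReal (ρ x) * g x ∂μ := fun g hg =>
    lintegral_withDensity_eq_lintegral_mul _ hρ.ennreal_ofReal hg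
  have : IsProbabilityMeasure ν := ⟨by
    rw [← lintegral_one, hint _ measurable_const]
    simp only [mul_one]
    rw [← ofReal_integral_eq_lintegral_ofReal hρi (ae_of_all _ hρ0), hρ1, ENNReal.ofReal_one]⟩
  have h1 : ‖∫ x, ρ x • d x ∂μ‖ₑ ≤ eLpNorm d 1 ν := by
    rw [eLpNorm_one_eq_lintegral_enorm, hint _ hd.enorm]
    refine (enorm_integral_le_lintegral_enorm _).trans (le_of_eq ?_)
    refine lintegral_congr fun x => ?_
    rw [enorm_smul, Real.enorm_of_nonneg (hρ0 x)]
  have h2 : eLpNorm d 1 ν ≤ eLpNorm d (ENNReal.ofReal p) ν :=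
    eLpNorm_le_eLpNorm_of_exponent_le (by simpa using hp) hd.aestronglyMeasurable
  have h3 : eLpNorm d (ENNReal.ofReal p) ν ^ p = ∫⁻ x, ‖d x‖ₑ ^ p ∂ν := by
    rw [eLpNorm_eq_lintegral_rpow_enorm_toReal (by simpa using hp0) ENNReal.ofReal_ne_top,
      ENNReal.toReal_ofReal hp0.le, ← ENNReal.rpow_mul, one_div_mul_cancel hp0.ne',
      ENNReal.rpow_one]
  calc ‖∫ x, ρ x • d x ∂μ‖ₑ ^ p ≤ eLpNorm d (ENNReal.ofReal p) ν ^ p := by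
        gcongr
        exact h1.trans h2
    _ = _ := by rw [h3, hint _ (hd.enorm.pow_const p)]

open ContinuousLinearMap in
/-- The difference quotient of a mollification is the average of translates of `diffQuot s p f` along
the diagonal of `ℝ^N × ℝ^N`. -/
theorem gagliardoEnergy_convolution_le {N : ℕ} {s p : ℝ} (hp : 1 ≤ p)
    (ρ : ContDiffBump (0 : Space N)) {f : Space N → ℝ} (hf : Continuous f) :
    gagliardoEnergy s p (convolution (ρ.normed volume) f (lsmul ℝ ℝ) volume)
      ≤ gagliardoEnergy s p f := by
  have hp0 : 0 < p := by linarith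
  set r : Space N → ℝ := ρ.normed volume with hr
  have hrc : Continuous r := ρ.continuous_normed
  have hrs : HasCompactSupport r := ρ.hasCompactSupport_normed
  have hex : ∀ x : Space N, Integrable (fun t => r t • f (x - t)) volume := fun x =>
    (hrc.smul (hf.comp (continuous_const.sub continuous_id))).integrable_of_hasCompactSupport
      hrs.smul_right
  have hquot : ∀ z : Space N × Space N,
      diffQuot s p (convolution r f (lsmul ℝ ℝ) volume) z
        = ∫ t, r t • diffQuot s p f (z - (t, t)) := by
    intro z
    simp only [diffQuot, convolution_def, lsmul_apply, Prod.fst_sub, Prod.snd_sub,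
      sub_sub_sub_cancel_right]
    rw [← integral_sub (hex _) (hex _), ← integral_div]
    refine integral_congr_ae (ae_of_all _ fun t => ?_)
    simp only [smul_eq_mul]
    ring
  have hinv : (volume : Measure (Space N × Space N)).IsAddRightInvariant := by
    rw [Measure.volume_eq_prod]
    infer_instance
  have hfq : Measurable (diffQuot s p f) := measurable_diffQuot hf.measurable
  rw [gagliardoEnergy_eq_lintegral_enorm hp0, gagliardoEnergy_eq_lintegral_enorm hp0]
  calc ∫⁻ z, ‖diffQuot s p (convolution r f (lsmul ℝ ℝ) volume) z‖ₑ ^ p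
      ≤ ∫⁻ z : Space N × Space N, ∫⁻ t : Space N,
          ENNReal.ofReal (r t) * ‖diffQuot s p f (z - (t, t))‖ₑ ^ p := by
        refine lintegral_mono fun z => ?_
        simp only [hquot]
        exact enorm_integral_smul_rpow_le hp hrc.measurable ρ.nonneg_normed ρ.integrable_normed
          ρ.integral_normed (by fun_prop)
    _ = ∫⁻ t : Space N, ∫⁻ z : Space N × Space N,
          ENNReal.ofReal (r t) * ‖diffQuot s p f (z - (t, t))‖ₑ ^ p := by
        refine lintegral_lintegral_swap (Measurable.aemeasurable ?_)
        have := hrc.measurable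
        unfold Function.uncurry
        fun_prop
    _ = ∫⁻ t : Space N, ENNReal.ofReal (r t) * ∫⁻ z, ‖diffQuot s p f z‖ₑ ^ p := by
        refine lintegral_congr fun t => ?_
        rw [lintegral_const_mul _ (by fun_prop),
          lintegral_sub_right_eq_self (fun z => ‖diffQuot s p f z‖ₑ ^ p) (t, t)]
    _ = ∫⁻ z, ‖diffQuot s p f z‖ₑ ^ p := by
        rw [lintegral_mul_const _ hrc.measurable.ennreal_ofReal,
          ← ofReal_integral_eq_lintegral_ofReal ρ.integrable_normed
            (ae_of_all _ ρ.nonneg_normed), ρ.integral_normed, ENNReal.ofReal_one, one_mul]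

open ContinuousLinearMap in
/-- A continuous function with compact support in `Ω` may be replaced by a test function with the
same integral and no larger energy. -/
theorem exists_testSpace_energy_le {N : ℕ} {s p : ℝ} (h : Exponents s p) {Ω : Set (Space N)}
    (hΩ : IsOpen Ω) {f : Space N → ℝ} (hf : Continuous f) (hfs : HasCompactSupport f)
    (hfΩ : tsupport f ⊆ Ω) :
    ∃ φ : TestSpace h Ω, gagliardoEnergy s p φ.fn ≤ gagliardoEnergy s p f ∧
      ∫ x, φ.fn x = ∫ x, f x := by
  obtain ⟨δ, hδ, hδΩ⟩ := hfs.isCompact.exists_cthickening_subset_open hΩ hfΩ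
  let ρ : ContDiffBump (0 : Space N) := ⟨δ / 2, δ, by positivity, by linarith⟩
  set g : Space N → ℝ := convolution (ρ.normed volume) f (lsmul ℝ ℝ) volume with hg
  have hgsmooth : ContDiff ℝ ∞ g :=
    ρ.hasCompactSupport_normed.contDiff_convolution_left _ ρ.contDiff_normed
      hf.locallyIntegrable
  have hgsupp : HasCompactSupport g := ρ.hasCompactSupport_normed.convolution _ hfs
  have hgΩ : tsupport g ⊆ Ω := by
    refine Subset.trans (closure_minimal ?_ Metric.isClosed_cthickening) hδΩ
    intro x hx
    obtain ⟨a, ha, b, hb, rfl⟩ := support_convolution_subset (lsmul ℝ ℝ) hx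
    rw [ρ.support_normed_eq, mem_ball_zero_iff] at ha
    refine Metric.mem_cthickening_of_dist_le _ b δ _ (subset_tsupport f hb) ?_
    rw [dist_eq_norm]
    simpa using ha.le
  refine ⟨⟨g, hgsmooth, hgsupp, hgΩ⟩, gagliardoEnergy_convolution_le h.one_lt_p.le ρ hf, ?_⟩
  have := integral_convolution (lsmul ℝ ℝ) (ρ.integrable_normed (μ := (volume : Measure (Space N))))
    (hf.integrable_of_hasCompactSupport hfs (μ := volume))
  rw [ρ.integral_normed, lsmul_apply, one_smul] at this
  exact this

/-! ### The space `D_0^{s,p}(Ω)` and its embedding into `L^1(Ω)` -/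

section HomSobolev

variable {N : ℕ} {s p : ℝ} {h : Exponents s p} {Ω : Set (Space N)}

theorem uniformContinuous_toL1 (hc : CompactlyEmbedsL1 h Ω) :
    UniformContinuous (TestSpace.toL1 (h := h) (Ω := Ω)) :=
  uniformContinuous_addMonoidHom_of_continuous (f := TestSpace.toL1 (h := h) (Ω := Ω)) hc.1

theorem embedL1_coe (hc : CompactlyEmbedsL1 h Ω) (φ : TestSpace h Ω) :
    embedL1 h Ω φ = TestSpace.toL1 φ :=
  UniformSpace.Completion.extension_coe (uniformContinuous_toL1 hc) φ

theorem continuous_embedL1 : Continuous (embedL1 h Ω) :=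
  UniformSpace.Completion.continuous_extension

/-- The embedding `embedL1` as a continuous linear map. -/
noncomputable def embedL1CLM (hc : CompactlyEmbedsL1 h Ω) :
    HomSobolev h Ω →L[ℝ] Lp ℝ 1 (volume.restrict Ω) where
  toFun := embedL1 h Ω
  map_add' u v := by
    refine UniformSpace.Completion.induction_on₂ u v (isClosed_eq ?_ ?_) fun φ ψ => ?_
    · exact continuous_embedL1.comp continuous_add
    · exact (continuous_embedL1.comp continuous_fst).add (continuous_embedL1.comp continuous_snd)
    · rw [← UniformSpace.Completion.coe_add, embedL1_coe hc, embedL1_coe hc, embedL1_coe hc,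
        map_add]
  map_smul' c u := by
    refine UniformSpace.Completion.induction_on u (isClosed_eq ?_ ?_) fun φ => ?_
    · exact continuous_embedL1.comp (continuous_const_smul c)
    · exact continuous_embedL1.const_smul c
    · rw [← UniformSpace.Completion.coe_smul, embedL1_coe hc, embedL1_coe hc, map_smul]
      rfl
  cont := continuous_embedL1

/-- The functional `u ↦ ∫_Ω u dx` on `D_0^{s,p}(Ω)`. -/
noncomputable def integralFunctional (hc : CompactlyEmbedsL1 h Ω) : HomSobolev h Ω →L[ℝ] ℝ :=
  (L1.integralCLM (μ := volume.restrict Ω) (E := ℝ)).comp (embedL1CLM hc)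

theorem integralFunctional_apply (hc : CompactlyEmbedsL1 h Ω) (u : HomSobolev h Ω) :
    integralFunctional hc u = ∫ x in Ω, embedL1 h Ω u x :=
  (L1.integral_eq _).symm.trans (L1.integral_eq_integral (embedL1 h Ω u))

theorem toFunction_ae_eq (hΩ : IsOpen Ω) (u : HomSobolev h Ω) :
    toFunction u =ᵐ[volume.restrict Ω] embedL1 h Ω u :=
  indicator_ae_eq_restrict hΩ.measurableSet

theorem torsionFunctional_eq (hΩ : IsOpen Ω) (hc : CompactlyEmbedsL1 h Ω) (u : HomSobolev h Ω) :
    torsionFunctional u = 1 / p * ‖u‖ ^ p - integralFunctional hc u := by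
  rw [torsionFunctional, integralFunctional_apply, integral_congr_ae (toFunction_ae_eq hΩ u)]

theorem embedL1_coe_ae_eq (hc : CompactlyEmbedsL1 h Ω) (φ : TestSpace h Ω) :
    embedL1 h Ω φ =ᵐ[volume.restrict Ω] φ.fn := by
  rw [embedL1_coe hc]
  exact φ.memLp_one.coeFn_toLp

theorem integralFunctional_coe (hc : CompactlyEmbedsL1 h Ω) (φ : TestSpace h Ω) :
    integralFunctional hc φ = ∫ x, φ.fn x := by
  rw [integralFunctional_apply, integral_congr_ae (embedL1_coe_ae_eq hc φ)]
  exact setIntegral_eq_integral_of_forall_compl_eq_zero fun x hx =>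
    image_eq_zero_of_notMem_tsupport fun hx' => hx (φ.2.2.2 hx')

namespace TestSpace

theorem norm_eq_eLpNorm (φ : TestSpace h Ω) :
    ‖φ‖ = (eLpNorm (diffQuot s p φ.fn) (ENNReal.ofReal p) volume).toReal :=
  gagliardoNorm_eq (by linarith [h.one_lt_p]) φ.fn

theorem diffQuot_sub (φ ψ : TestSpace h Ω) :
    diffQuot s p (φ - ψ).fn = diffQuot s p φ.fn - diffQuot s p ψ.fn := by
  funext z
  change (φ.fn z.1 - ψ.fn z.1 - (φ.fn z.2 - ψ.fn z.2)) / _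
    = (φ.fn z.1 - φ.fn z.2) / _ - (ψ.fn z.1 - ψ.fn z.2) / _
  ring

theorem diffQuot_midpoint (φ ψ : TestSpace h Ω) (z : Space N × Space N) :
    diffQuot s p ((1 / 2 : ℝ) • (φ + ψ)).fn z
      = (diffQuot s p φ.fn z + diffQuot s p ψ.fn z) / 2 := by
  change ((1 / 2 : ℝ) * (φ.fn z.1 + ψ.fn z.1) - (1 / 2 : ℝ) * (φ.fn z.2 + ψ.fn z.2)) / _
    = ((φ.fn z.1 - φ.fn z.2) / _ + (ψ.fn z.1 - ψ.fn z.2) / _) / 2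
  ring

theorem ofReal_norm_sub (φ ψ : TestSpace h Ω) :
    ENNReal.ofReal ‖φ - ψ‖
      = eLpNorm (diffQuot s p φ.fn - diffQuot s p ψ.fn) (ENNReal.ofReal p) volume := by
  rw [norm_eq_eLpNorm, ENNReal.ofReal_toReal (memLp_quot _).eLpNorm_ne_top, diffQuot_sub]

theorem norm_rpow_eq_toReal (φ : TestSpace h Ω) :
    ‖φ‖ ^ p = (gagliardoEnergy s p φ.fn).toReal := by
  have hp0 : 0 < p := by linarith [h.one_lt_p]
  rw [norm_def, gagliardoNorm, ← Real.rpow_mul ENNReal.toReal_nonneg,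
    one_div_mul_cancel hp0.ne', Real.rpow_one]

theorem integrable_abs_diffQuot_rpow (φ : TestSpace h Ω) :
    Integrable fun z => |diffQuot s p φ.fn z| ^ p := by
  have hp0 : 0 < p := by linarith [h.one_lt_p]
  have := φ.memLp_quot.integrable_norm_rpow (by simpa using hp0) ENNReal.ofReal_ne_top
  rwa [ENNReal.toReal_ofReal hp0.le] at this

theorem norm_rpow_eq_integral (φ : TestSpace h Ω) :
    ‖φ‖ ^ p = ∫ z, |diffQuot s p φ.fn z| ^ p := by
  have hp0 : 0 < p := by linarith [h.one_lt_p]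
  rw [norm_rpow_eq_toReal, gagliardoEnergy_eq_lintegral_enorm hp0,
    integral_eq_lintegral_of_nonneg_ae (ae_of_all _ fun z => by positivity)
      φ.integrable_abs_diffQuot_rpow.1]
  congr 1
  refine lintegral_congr fun z => ?_
  rw [← ofReal_norm, ENNReal.ofReal_rpow_of_nonneg (norm_nonneg _) hp0.le, Real.norm_eq_abs]

end TestSpace

/-- The inequality `exists_abs_sub_rpow_le` for the Gagliardo norm. -/
theorem exists_norm_sub_rpow_le (h : Exponents s p) (Ω : Set (Space N)) {ε : ℝ} (hε : 0 < ε) :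
    ∃ C : ℝ, 0 ≤ C ∧ ∀ u v : HomSobolev h Ω, ‖u - v‖ ^ p ≤ ε * (‖u‖ ^ p + ‖v‖ ^ p)
      + C * ((‖u‖ ^ p + ‖v‖ ^ p) / 2 - ‖(1 / 2 : ℝ) • (u + v)‖ ^ p) := by
  have hp0 : 0 < p := by linarith [h.one_lt_p]
  obtain ⟨C, hC0, hC⟩ := exists_abs_sub_rpow_le h.one_lt_p hε
  refine ⟨C, hC0, fun u v => ?_⟩
  have hcont : ∀ f : HomSobolev h Ω × HomSobolev h Ω → HomSobolev h Ω, Continuous f →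
      Continuous fun z => ‖f z‖ ^ p := fun f hf => hf.norm.rpow_const fun _ => Or.inr hp0.le
  refine UniformSpace.Completion.induction_on₂ u v (isClosed_le ?_ ?_) fun φ ψ => ?_
  · exact hcont _ (continuous_fst.sub continuous_snd)
  · have h1 := hcont _ continuous_fst
    have h2 := hcont _ continuous_snd
    have h3 := hcont _ ((continuous_fst.add continuous_snd).const_smul (1 / 2 : ℝ))
    exact ((h1.add h2).const_mul ε).add ((((h1.add h2).div_const 2).sub h3).const_mul C)
  · rw [← UniformSpace.Completion.coe_sub, ← UniformSpace.Completion.coe_add,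
      ← UniformSpace.Completion.coe_smul]
    simp only [UniformSpace.Completion.norm_coe]
    have i1 := φ.integrable_abs_diffQuot_rpow
    have i2 := ψ.integrable_abs_diffQuot_rpow
    have i3 := ((1 / 2 : ℝ) • (φ + ψ)).integrable_abs_diffQuot_rpow
    have i4 := (φ - ψ).integrable_abs_diffQuot_rpow
    have i5 : Integrable fun z => |diffQuot s p φ.fn z| ^ p + |diffQuot s p ψ.fn z| ^ p :=
      i1.add i2
    have i6 : Integrable fun z => (|diffQuot s p φ.fn z| ^ p + |diffQuot s p ψ.fn z| ^ p) / 2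
        - |diffQuot s p ((1 / 2 : ℝ) • (φ + ψ)).fn z| ^ p := (i5.div_const 2).sub i3
    simp only [TestSpace.norm_rpow_eq_integral]
    rw [← integral_add i1 i2, ← integral_div, ← integral_sub (i5.div_const 2) i3,
      ← integral_const_mul, ← integral_const_mul,
      ← integral_add (i5.const_mul ε) (i6.const_mul C)]
    refine integral_mono i4 ((i5.const_mul ε).add (i6.const_mul C)) fun z => ?_
    simp only [TestSpace.diffQuot_midpoint, TestSpace.diffQuot_sub, Pi.sub_apply]
    exact hC _ _

/-- The norm of `D_0^{s,p}(Ω)` is bounded by the Gagliardo energy of the function that represents an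
element. An approximating sequence of test functions is Cauchy for the Gagliardo norm and converges
almost everywhere, which identifies its limit. -/
theorem ofReal_norm_rpow_le_gagliardoEnergy (hΩ : IsOpen Ω) (hc : CompactlyEmbedsL1 h Ω)
    (u : HomSobolev h Ω) :
    ENNReal.ofReal (‖u‖ ^ p) ≤ gagliardoEnergy s p (toFunction u) := by
  have hp0 : 0 < p := by linarith [h.one_lt_p]
  have hex : ∀ n : ℕ, ∃ φ : TestSpace h Ω, dist u φ < (1 / 2 : ℝ) ^ n / 2 := fun n =>
    UniformSpace.Completion.denseRange_coe.exists_dist_lt u (by positivity)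
  choose φ hφ using hex
  have hlim : Tendsto (fun n => (φ n : HomSobolev h Ω)) atTop (𝓝 u) := by
    rw [tendsto_iff_dist_tendsto_zero]
    refine squeeze_zero (g := fun n : ℕ => (1 / 2 : ℝ) ^ n / 2) (fun _ => dist_nonneg)
      (fun n => by rw [dist_comm]; exact (hφ n).le) ?_
    simpa only [zero_div] using (tendsto_pow_atTop_nhds_zero_of_lt_one
      (by norm_num : (0 : ℝ) ≤ 1 / 2) (by norm_num)).div_const 2
  -- A subsequence of a fast converging sequence still satisfies the geometric Cauchy bound.
  obtain ⟨ns, hns, hae⟩ := (tendstoInMeasure_of_tendsto_Lp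
    ((continuous_embedL1.tendsto u).comp hlim)).exists_seq_tendsto_ae
  have hcoe : ∀ᵐ x ∂volume.restrict Ω, ∀ n, embedL1 h Ω (φ n) x = (φ n).fn x :=
    ae_all_iff.2 fun n => embedL1_coe_ae_eq hc (φ n)
  have hpt : ∀ᵐ x : Space N, Tendsto (fun n => (φ (ns n)).fn x) atTop (𝓝 (toFunction u x)) := by
    filter_upwards [(ae_restrict_iff' hΩ.measurableSet).1 hae,
      (ae_restrict_iff' hΩ.measurableSet).1 hcoe] with x h1 h2
    by_cases hx : x ∈ Ω
    · rw [toFunction, indicator_of_mem hx]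
      refine (h1 hx).congr fun n => ?_
      exact h2 hx (ns n)
    · rw [toFunction, indicator_of_notMem hx]
      refine tendsto_const_nhds.congr fun n => ?_
      exact (image_eq_zero_of_notMem_tsupport fun hx' => hx ((φ (ns n)).2.2.2 hx')).symm
  have hquot : ∀ᵐ z : Space N × Space N, Tendsto (fun n => diffQuot s p (φ (ns n)).fn z) atTop
      (𝓝 (diffQuot s p (toFunction u) z)) := by
    rw [Measure.volume_eq_prod]
    filter_upwards [Measure.quasiMeasurePreserving_fst.ae hpt,
      Measure.quasiMeasurePreserving_snd.ae hpt] with z h1 h2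
    exact (h1.sub h2).div_const _
  have hmeas : ∀ n, AEStronglyMeasurable (diffQuot s p (φ (ns n)).fn) volume := fun n =>
    (φ (ns n)).memLp_quot.1
  have hmeasu : AEStronglyMeasurable (diffQuot s p (toFunction u)) volume :=
    aestronglyMeasurable_of_tendsto_ae atTop hmeas hquot
  have hB : ∑' n : ℕ, (2⁻¹ : ℝ≥0∞) ^ n ≠ ⊤ := by
    rw [ENNReal.tsum_geometric_two]
    simp
  have hcauchy : ∀ M n m : ℕ, M ≤ n → M ≤ m →
      eLpNorm (diffQuot s p (φ (ns n)).fn - diffQuot s p (φ (ns m)).fn) (ENNReal.ofReal p) volume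
        < (2⁻¹ : ℝ≥0∞) ^ M := by
    intro M n m hn hm
    rw [← TestSpace.ofReal_norm_sub]
    have hpow : ∀ k, M ≤ k → dist u (φ (ns k)) < (1 / 2 : ℝ) ^ M / 2 := fun k hk =>
      (hφ _).trans_le (div_le_div_of_nonneg_right
        (pow_le_pow_of_le_one (by norm_num) (by norm_num) (hk.trans (hns.le_apply))) (by norm_num))
    have hlt : ‖φ (ns n) - φ (ns m)‖ < (1 / 2 : ℝ) ^ M := by
      rw [← UniformSpace.Completion.norm_coe, UniformSpace.Completion.coe_sub, ← dist_eq_norm]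
      calc dist (φ (ns n) : HomSobolev h Ω) (φ (ns m))
          ≤ dist u (φ (ns n)) + dist u (φ (ns m)) := dist_triangle_left _ _ _
        _ < (1 / 2 : ℝ) ^ M / 2 + (1 / 2 : ℝ) ^ M / 2 := add_lt_add (hpow n hn) (hpow m hm)
        _ = _ := add_halves _
    have h2 : (2⁻¹ : ℝ≥0∞) ^ M = ENNReal.ofReal ((1 / 2 : ℝ) ^ M) := by
      rw [ENNReal.ofReal_pow (by norm_num), one_div, ENNReal.ofReal_inv_of_pos (by norm_num),
        ENNReal.ofReal_ofNat]
    rw [h2]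
    exact (ENNReal.ofReal_lt_ofReal_iff (by positivity)).2 hlt
  have hLp := Lp.cauchy_tendsto_of_tendsto (p := ENNReal.ofReal p) hmeas _ hB hcauchy hquot
  have hnorm : Tendsto (fun n => ENNReal.ofReal ‖φ (ns n)‖) atTop (𝓝 (ENNReal.ofReal ‖u‖)) := by
    refine (ENNReal.continuous_ofReal.tendsto _).comp ?_
    refine ((hlim.comp hns.tendsto_atTop).norm).congr fun n => ?_
    exact UniformSpace.Completion.norm_coe _
  have hle : ENNReal.ofReal ‖u‖ ≤
      0 + eLpNorm (diffQuot s p (toFunction u)) (ENNReal.ofReal p) volume := by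
    refine le_of_tendsto_of_tendsto' hnorm (hLp.add tendsto_const_nhds) fun n => ?_
    rw [TestSpace.norm_eq_eLpNorm, ENNReal.ofReal_toReal (TestSpace.memLp_quot _).eLpNorm_ne_top]
    have h3 := eLpNorm_add_le (p := ENNReal.ofReal p) ((hmeas n).sub hmeasu) hmeasu
      (by simpa using h.one_lt_p.le)
    rwa [sub_add_cancel] at h3
  rw [zero_add, eLpNorm_diffQuot hp0] at hle
  rw [← ENNReal.ofReal_rpow_of_nonneg (norm_nonneg _) hp0.le]
  calc ENNReal.ofReal ‖u‖ ^ p ≤ (gagliardoEnergy s p (toFunction u) ^ (1 / p)) ^ p := by gcongr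
    _ = _ := by rw [← ENNReal.rpow_mul, one_div_mul_cancel hp0.ne', ENNReal.rpow_one]

end HomSobolev

/-! ### Existence of the torsion function -/

/-- The direct method without weak compactness: if the norm satisfies the quantitative convexity
estimate `hgap`, minimizing sequences of `‖·‖ ^ p / p - ℓ` are Cauchy. -/
theorem exists_forall_norm_rpow_sub_le {X : Type*} [NormedAddCommGroup X] [NormedSpace ℝ X]
    [CompleteSpace X] {p : ℝ} (hp : 1 < p)
    (hgap : ∀ ε : ℝ, 0 < ε → ∃ C : ℝ, 0 ≤ C ∧ ∀ u v : X, ‖u - v‖ ^ p ≤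
      ε * (‖u‖ ^ p + ‖v‖ ^ p) + C * ((‖u‖ ^ p + ‖v‖ ^ p) / 2 - ‖(1 / 2 : ℝ) • (u + v)‖ ^ p))
    (ℓ : X →L[ℝ] ℝ) :
    ∃ w : X, ∀ v : X, 1 / p * ‖w‖ ^ p - ℓ w ≤ 1 / p * ‖v‖ ^ p - ℓ v := by
  have hp0 : 0 < p := by linarith
  set J : X → ℝ := fun v => 1 / p * ‖v‖ ^ p - ℓ v with hJ
  have hJc : Continuous J :=
    ((continuous_norm.rpow_const fun _ => Or.inr hp0.le).const_mul (1 / p)).sub ℓ.continuous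
  -- Young's inequality gives the coercivity bound.
  obtain ⟨M, hM⟩ : ∃ M : ℝ, ∀ v, ‖v‖ - M ≤ J v := by
    refine ⟨(‖ℓ‖ + 1) ^ (p.conjExponent) / p.conjExponent, fun v => ?_⟩
    have hy := Real.young_inequality_of_nonneg (norm_nonneg v)
      (show 0 ≤ ‖ℓ‖ + 1 by positivity) (Real.HolderConjugate.conjExponent hp)
    have hl : ℓ v ≤ ‖ℓ‖ * ‖v‖ := (le_abs_self _).trans (ℓ.le_opNorm v)
    have : 1 / p * ‖v‖ ^ p = ‖v‖ ^ p / p := by ring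
    simp only [hJ, this]
    nlinarith
  have hbdd : BddBelow (range J) := by
    refine ⟨-M, ?_⟩
    rintro _ ⟨v, rfl⟩
    linarith [hM v, norm_nonneg v]
  set m := sInf (range J) with hm
  have hmle : ∀ v, m ≤ J v := fun v => csInf_le hbdd (mem_range_self v)
  have hseq : ∀ n : ℕ, ∃ v, J v < m + 1 / ((n : ℝ) + 1) := by
    intro n
    obtain ⟨_, ⟨v, rfl⟩, hv⟩ := exists_lt_of_csInf_lt (range_nonempty J)
      (show sInf (range J) < m + 1 / ((n : ℝ) + 1) from lt_add_of_pos_right _ (by positivity))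
    exact ⟨v, hv⟩
  choose v hv using hseq
  set R := m + 1 + M with hR
  have hvR : ∀ n, ‖v n‖ ≤ R := by
    intro n
    have h1 : 1 / ((n : ℝ) + 1) ≤ 1 := by
      rw [div_le_one (by positivity)]
      linarith [show (0 : ℝ) ≤ n from Nat.cast_nonneg n]
    linarith [hM (v n), hv n]
  have hR0 : 0 ≤ R := (norm_nonneg _).trans (hvR 0)
  have hcauchy : CauchySeq v := by
    refine Metric.cauchySeq_iff'.2 fun η hη => ?_
    have hηp : 0 < η ^ p := Real.rpow_pos_of_pos hη p
    have hRp : 0 ≤ R ^ p := Real.rpow_nonneg hR0 p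
    obtain ⟨C, hC0, hC⟩ := hgap (η ^ p / (4 * (R ^ p + 1))) (by positivity)
    obtain ⟨k, hk⟩ := exists_nat_gt (2 * (C * p) / η ^ p)
    refine ⟨k, fun n hn => ?_⟩
    have hk1 : C * p * (1 / ((k : ℝ) + 1)) < η ^ p / 2 := by
      rw [div_lt_iff₀ hηp] at hk
      rw [mul_one_div, div_lt_iff₀ (by positivity)]
      nlinarith
    have hJn : J (v n) ≤ m + 1 / ((k : ℝ) + 1) := by
      refine (hv n).le.trans ?_
      gcongr
    have hmid : m ≤ 1 / p * ‖(1 / 2 : ℝ) • (v n + v k)‖ ^ p - (ℓ (v n) + ℓ (v k)) / 2 := by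
      refine (hmle ((1 / 2 : ℝ) • (v n + v k))).trans (le_of_eq ?_)
      simp only [hJ, map_smul, map_add, smul_eq_mul]
      ring
    have hdef : (‖v n‖ ^ p + ‖v k‖ ^ p) / 2 - ‖(1 / 2 : ℝ) • (v n + v k)‖ ^ p
        ≤ p * (1 / ((k : ℝ) + 1)) := by
      have h1 : 1 / p * ((‖v n‖ ^ p + ‖v k‖ ^ p) / 2 - ‖(1 / 2 : ℝ) • (v n + v k)‖ ^ p)
          ≤ 1 / ((k : ℝ) + 1) := by
        have h2 := (hv k).le
        simp only [hJ] at h2 hJn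
        linarith
      rwa [one_div_mul_eq_div, div_le_iff₀' hp0] at h1
    have hsum : ‖v n‖ ^ p + ‖v k‖ ^ p ≤ 2 * (R ^ p + 1) := by
      have h1 : ‖v n‖ ^ p ≤ R ^ p := by
        gcongr
        exact hvR n
      have h2 : ‖v k‖ ^ p ≤ R ^ p := by
        gcongr
        exact hvR k
      linarith
    have hlt : ‖v n - v k‖ ^ p < η ^ p := by
      calc ‖v n - v k‖ ^ p ≤ _ := hC (v n) (v k)
        _ ≤ η ^ p / (4 * (R ^ p + 1)) * (2 * (R ^ p + 1)) + C * (p * (1 / ((k : ℝ) + 1))) := by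
            gcongr
        _ = η ^ p / 2 + C * p * (1 / ((k : ℝ) + 1)) := by
            field_simp
            ring
        _ < η ^ p := by linarith
    rw [dist_eq_norm]
    exact (Real.rpow_lt_rpow_iff (norm_nonneg _) hη.le hp0).1 hlt
  obtain ⟨w, hw⟩ := cauchySeq_tendsto_of_complete hcauchy
  refine ⟨w, fun u => le_trans ?_ (hmle u)⟩
  refine le_of_tendsto_of_tendsto' ((hJc.tendsto w).comp hw) ?_ fun n => (hv n).le
  simpa using tendsto_const_nhds.add (tendsto_one_div_add_atTop_nhds_zero_nat (𝕜 := ℝ))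

section TorsionFunction

variable {N : ℕ} {s p : ℝ} {h : Exponents s p} {Ω : Set (Space N)}

/-- The choice in the definition of `torsionFunction` is made from a nonempty set. -/
theorem torsionFunctional_torsionFunction_le (hΩ : IsOpen Ω) (hc : CompactlyEmbedsL1 h Ω)
    (v : HomSobolev h Ω) : torsionFunctional (torsionFunction h Ω) ≤ torsionFunctional v := by
  have hex : ∃ w : HomSobolev h Ω, ∀ v : HomSobolev h Ω,
      torsionFunctional w ≤ torsionFunctional v := by
    simp only [torsionFunctional_eq hΩ hc]
    exact exists_forall_norm_rpow_sub_le h.one_lt_p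
      (fun ε hε => exists_norm_sub_rpow_le h Ω hε) _
  exact Classical.epsilon_spec hex v

end TorsionFunction

/-! ### Comparison of the torsion function with `ℓ^p` combinations -/

section LpCombination

theorem integrable_lpPair {α : Type*} [MeasurableSpace α] {μ : Measure α} {p : ℝ} (hp : 1 ≤ p)
    {f g : α → ℝ} (hf : Integrable f μ) (hg : Integrable g μ) :
    Integrable (fun x => lpPair p (f x) (g x)) μ := by
  refine (hf.norm.add hg.norm).mono' ?_ (ae_of_all _ fun x => ?_)
  · have hp0 : 0 < p := by linarith
    exact Continuous.comp_aestronglyMeasurable₂ (g := lpPair p) (continuous_lpPair hp0) hf.1 hg.1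
  · rw [Real.norm_of_nonneg (lpPair_nonneg _ _)]
    exact lpPair_le hp _ _

theorem continuous_integral_lpPair {α : Type*} [MeasurableSpace α] {μ : Measure α} {p : ℝ}
    (hp : 1 ≤ p) :
    Continuous fun z : Lp ℝ 1 μ × Lp ℝ 1 μ => ∫ x, lpPair p (z.1 x) (z.2 x) ∂μ := by
  have hi : ∀ f : Lp ℝ 1 μ, Integrable f μ := L1.integrable_coeFn
  refine (LipschitzWith.of_dist_le_mul (K := 2) fun z z' => ?_).continuous
  rw [Real.dist_eq, ← integral_sub (integrable_lpPair hp (hi _) (hi _))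
    (integrable_lpPair hp (hi _) (hi _))]
  have hb : ∀ x, |lpPair p (z.1 x) (z.2 x) - lpPair p (z'.1 x) (z'.2 x)|
      ≤ |z.1 x - z'.1 x| + |z.2 x - z'.2 x| := fun x =>
    (abs_lpPair_sub_le hp _ _ _ _).trans (lpPair_le hp _ _)
  have hd : ∀ f g : Lp ℝ 1 μ, ∫ x, |f x - g x| ∂μ = dist f g := by
    intro f g
    rw [dist_eq_norm, L1.norm_eq_integral_norm]
    refine integral_congr_ae ?_
    filter_upwards [Lp.coeFn_sub f g] with x hx
    rw [hx, Pi.sub_apply, Real.norm_eq_abs]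
  have hi2 : ∀ f g : Lp ℝ 1 μ, Integrable (fun x => |f x - g x|) μ := fun f g =>
    ((hi f).sub (hi g)).abs
  have hi3 : Integrable (fun x => |z.1 x - z'.1 x| + |z.2 x - z'.2 x|) μ :=
    (hi2 _ _).add (hi2 _ _)
  calc |∫ x, (lpPair p (z.1 x) (z.2 x) - lpPair p (z'.1 x) (z'.2 x)) ∂μ|
      ≤ ∫ x, (|z.1 x - z'.1 x| + |z.2 x - z'.2 x|) ∂μ := by
        rw [← Real.norm_eq_abs]
        exact norm_integral_le_of_norm_le hi3 (ae_of_all _ hb)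
    _ = dist z.1 z'.1 + dist z.2 z'.2 := by
        rw [integral_add (hi2 _ _) (hi2 _ _), hd, hd]
    _ ≤ (2 : NNReal) * dist z z' := by
        have h1 : dist z.1 z'.1 ≤ dist z z' := le_max_left _ _
        have h2 : dist z.2 z'.2 ≤ dist z z' := le_max_right _ _
        rw [NNReal.coe_ofNat]
        linarith

variable {N : ℕ} {s p : ℝ}

/-- Hidden convexity of the Gagliardo energy: the reverse triangle inequality in `ℓ^p` holds
pointwise for the difference quotients. -/
theorem gagliardoEnergy_lpPair_le (hp : 1 ≤ p) {u v : Space N → ℝ} (hu : Measurable u) :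
    gagliardoEnergy s p (fun x => lpPair p (u x) (v x))
      ≤ gagliardoEnergy s p u + gagliardoEnergy s p v := by
  have hp0 : 0 < p := by linarith
  unfold gagliardoEnergy
  rw [← lintegral_add_left (by fun_prop)]
  refine lintegral_mono fun z => ?_
  rw [← ENNReal.ofReal_add (by positivity) (by positivity), ← add_div]
  refine ENNReal.ofReal_le_ofReal ?_
  gcongr
  rw [← lpPair_rpow hp0]
  gcongr
  exact abs_lpPair_sub_le hp _ _ _ _

variable {h : Exponents s p} {Ω : Set (Space N)}

/-- The test functions are combined and the result mollified, so that the competitor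
is a test function again. -/
theorem torsionFunctional_le_lpPair_coe (hΩ : IsOpen Ω) (hc : CompactlyEmbedsL1 h Ω)
    (φ ψ : TestSpace h Ω) :
    torsionFunctional (torsionFunction h Ω) ≤
      1 / p * (‖φ‖ ^ p + ‖ψ‖ ^ p) - ∫ x in Ω, lpPair p (φ.fn x) (ψ.fn x) := by
  have hp0 : 0 < p := by linarith [h.one_lt_p]
  set f : Space N → ℝ := fun x => lpPair p (φ.fn x) (ψ.fn x) with hf
  have hfc : Continuous f :=
    (continuous_lpPair hp0).comp (φ.2.1.continuous.prodMk ψ.2.1.continuous)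
  have hzero : ∀ x ∉ tsupport φ.fn ∪ tsupport ψ.fn, f x = 0 := by
    intro x hx
    rw [mem_union, not_or] at hx
    simp only [hf]
    rw [image_eq_zero_of_notMem_tsupport hx.1, image_eq_zero_of_notMem_tsupport hx.2,
      lpPair_zero_zero hp0]
  have hfsub : tsupport f ⊆ tsupport φ.fn ∪ tsupport ψ.fn := by
    refine closure_minimal (fun x hx => ?_) ((isClosed_tsupport _).union (isClosed_tsupport _))
    by_contra hx'
    exact hx (hzero x hx')
  have hfs : HasCompactSupport f :=
    HasCompactSupport.intro (φ.2.2.1.isCompact.union ψ.2.2.1.isCompact) fun x hx => hzero x hx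
  have hfΩ : tsupport f ⊆ Ω := hfsub.trans (union_subset φ.2.2.2 ψ.2.2.2)
  obtain ⟨χ, hχE, hχi⟩ := exists_testSpace_energy_le h hΩ hfc hfs hfΩ
  have hφE : gagliardoEnergy s p φ.fn ≠ ⊤ := (gagliardoEnergy_lt_top h φ.2.1 φ.2.2.1).ne
  have hψE : gagliardoEnergy s p ψ.fn ≠ ⊤ := (gagliardoEnergy_lt_top h ψ.2.1 ψ.2.2.1).ne
  have hnorm : ‖χ‖ ^ p ≤ ‖φ‖ ^ p + ‖ψ‖ ^ p := by
    rw [TestSpace.norm_rpow_eq_toReal, TestSpace.norm_rpow_eq_toReal,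
      TestSpace.norm_rpow_eq_toReal, ← ENNReal.toReal_add hφE hψE]
    exact ENNReal.toReal_mono (ENNReal.add_ne_top.2 ⟨hφE, hψE⟩) (hχE.trans
      (gagliardoEnergy_lpPair_le h.one_lt_p.le φ.2.1.continuous.measurable))
  have hint : ∫ x in Ω, f x = ∫ x, f x :=
    setIntegral_eq_integral_of_forall_compl_eq_zero fun x hx =>
      image_eq_zero_of_notMem_tsupport fun hx' => hx (hfΩ hx')
  calc torsionFunctional (torsionFunction h Ω) ≤ torsionFunctional (χ : HomSobolev h Ω) :=
        torsionFunctional_torsionFunction_le hΩ hc _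
    _ = 1 / p * ‖χ‖ ^ p - ∫ x in Ω, f x := by
        rw [torsionFunctional_eq hΩ hc, integralFunctional_coe, hχi, hint,
          UniformSpace.Completion.norm_coe]
    _ ≤ _ := by gcongr

/-- The comparison for arbitrary `u` and `v`, by density: both sides are continuous in the pair, and
it is immaterial whether `‖(u, v)‖_p` belongs to `D_0^{s,p}(Ω)`. -/
theorem torsionFunctional_le_lpPair (hΩ : IsOpen Ω) (hc : CompactlyEmbedsL1 h Ω)
    (u v : HomSobolev h Ω) :
    torsionFunctional (torsionFunction h Ω) ≤
      1 / p * (‖u‖ ^ p + ‖v‖ ^ p) - ∫ x in Ω, lpPair p (embedL1 h Ω u x) (embedL1 h Ω v x) := by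
  have hp0 : 0 < p := by linarith [h.one_lt_p]
  refine UniformSpace.Completion.induction_on₂ u v (isClosed_le continuous_const ?_) fun φ ψ => ?_
  · have h1 : Continuous fun z : HomSobolev h Ω × HomSobolev h Ω => ‖z.1‖ ^ p + ‖z.2‖ ^ p :=
      (continuous_fst.norm.rpow_const fun _ => Or.inr hp0.le).add
        (continuous_snd.norm.rpow_const fun _ => Or.inr hp0.le)
    exact (h1.const_mul (1 / p)).sub ((continuous_integral_lpPair h.one_lt_p.le).comp
      (continuous_embedL1.prodMap continuous_embedL1))
  · have hcongr : ∫ x in Ω, lpPair p (embedL1 h Ω φ x) (embedL1 h Ω ψ x)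
        = ∫ x in Ω, lpPair p (φ.fn x) (ψ.fn x) := by
      refine integral_congr_ae ?_
      filter_upwards [embedL1_coe_ae_eq hc φ, embedL1_coe_ae_eq hc ψ] with x h1 h2
      rw [h1, h2]
    rw [hcongr, UniformSpace.Completion.norm_coe, UniformSpace.Completion.norm_coe]
    exact torsionFunctional_le_lpPair_coe hΩ hc φ ψ

/-- Minimality of the torsion function along the curve `c ↦ ‖(w, c u)‖_p`. -/
theorem integral_lpPair_torsionFunction_le (hΩ : IsOpen Ω) (hc : CompactlyEmbedsL1 h Ω)
    (u : HomSobolev h Ω) :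
    ∫ x in Ω, lpPair p (embedL1 h Ω (torsionFunction h Ω) x) (embedL1 h Ω u x)
      ≤ (∫ x in Ω, embedL1 h Ω (torsionFunction h Ω) x) + 1 / p * ‖u‖ ^ p := by
  have h1 := torsionFunctional_le_lpPair hΩ hc (torsionFunction h Ω) u
  rw [torsionFunctional_eq hΩ hc, integralFunctional_apply] at h1
  linarith

theorem torsionFunction_nonneg_ae (hΩ : IsOpen Ω) (hc : CompactlyEmbedsL1 h Ω) :
    ∀ᵐ x ∂volume.restrict Ω, 0 ≤ embedL1 h Ω (torsionFunction h Ω) x := by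
  have hp0 : 0 < p := by linarith [h.one_lt_p]
  set w := embedL1 h Ω (torsionFunction h Ω) with hw
  have hwi : Integrable w (volume.restrict Ω) := L1.integrable_coeFn w
  have h1 := integral_lpPair_torsionFunction_le hΩ hc 0
  have h0 : embedL1 h Ω 0 =ᵐ[volume.restrict Ω] 0 := by
    rw [show embedL1 h Ω 0 = 0 from (embedL1CLM hc).map_zero]
    exact Lp.coeFn_zero _ _ _
  have h2 : ∫ x in Ω, lpPair p (w x) (embedL1 h Ω 0 x) = ∫ x in Ω, |w x| := by
    refine integral_congr_ae ?_
    filter_upwards [h0] with x hx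
    rw [hx, Pi.zero_apply, lpPair_zero_right hp0]
  rw [h2, norm_zero, Real.zero_rpow hp0.ne', mul_zero, add_zero] at h1
  have h3 : ∫ x in Ω, (|w x| - w x) = 0 := by
    refine le_antisymm ?_ (integral_nonneg fun x => sub_nonneg.2 (le_abs_self _))
    rw [integral_sub hwi.abs hwi]
    linarith
  rw [integral_eq_zero_iff_of_nonneg (fun x => sub_nonneg.2 (le_abs_self _))
    (hwi.abs.sub hwi)] at h3
  filter_upwards [h3] with x hx
  rw [Pi.zero_apply, sub_eq_zero] at hx
  rw [← hx]
  exact abs_nonneg _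

/-- The weighted inequality with the weight `w` replaced by the larger `‖(w, c u)‖_p`. -/
theorem lintegral_div_lpPair_le (hΩ : IsOpen Ω) (hc : CompactlyEmbedsL1 h Ω)
    (u : HomSobolev h Ω) {c : ℝ} (hc0 : 0 < c) :
    ∫⁻ x in Ω, ENNReal.ofReal |embedL1 h Ω u x| ^ p / ENNReal.ofReal
        (lpPair p (embedL1 h Ω (torsionFunction h Ω) x) (c * embedL1 h Ω u x)) ^ (p - 1)
      ≤ ENNReal.ofReal (‖u‖ ^ p) := by
  have hp := h.one_lt_p
  have hp0 : 0 < p := by linarith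
  set w := embedL1 h Ω (torsionFunction h Ω) with hw
  set g := embedL1 h Ω u with hg
  have hwi : Integrable w (volume.restrict Ω) := L1.integrable_coeFn w
  have hgi : Integrable g (volume.restrict Ω) := L1.integrable_coeFn g
  have hσi : Integrable (fun x => lpPair p (w x) (c * g x)) (volume.restrict Ω) :=
    integrable_lpPair hp.le hwi (hgi.const_mul c)
  have hcp : 0 < c ^ p := Real.rpow_pos_of_pos hc0 p
  have hpt : ∀ᵐ x ∂volume.restrict Ω,
      ENNReal.ofReal |g x| ^ p / ENNReal.ofReal (lpPair p (w x) (c * g x)) ^ (p - 1)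
        ≤ ENNReal.ofReal (p / c ^ p * (lpPair p (w x) (c * g x) - w x)) := by
    filter_upwards [torsionFunction_nonneg_ae hΩ hc] with x hx
    set σ := lpPair p (w x) (c * g x) with hσ
    have hσ0 : 0 ≤ σ := lpPair_nonneg _ _
    have hb := abs_rpow_le_lpPair_sub hp (w x) (c * g x)
    have hwσ : |w x| ≤ σ := abs_le_lpPair hp0 _ _
    rw [← hσ, abs_mul, abs_of_pos hc0, Real.mul_rpow hc0.le (abs_nonneg _)] at hb
    rw [abs_of_nonneg hx] at hb hwσ
    refine ENNReal.div_le_of_le_mul ?_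
    rw [ENNReal.ofReal_rpow_of_nonneg (abs_nonneg _) hp0.le,
      ENNReal.ofReal_rpow_of_nonneg hσ0 (by linarith),
      ← ENNReal.ofReal_mul (mul_nonneg (by positivity) (sub_nonneg.2 hwσ))]
    refine ENNReal.ofReal_le_ofReal ?_
    calc |g x| ^ p = c ^ p * |g x| ^ p / c ^ p := by field_simp
      _ ≤ p * (σ - w x) * σ ^ (p - 1) / c ^ p := by gcongr
      _ = _ := by ring
  have hsmul : embedL1 h Ω (c • u) =ᵐ[volume.restrict Ω] fun x => c * g x := by
    rw [show embedL1 h Ω (c • u) = c • embedL1 h Ω u from (embedL1CLM hc).map_smul c u]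
    exact Lp.coeFn_smul _ _
  have hK := integral_lpPair_torsionFunction_le hΩ hc (c • u)
  have hcongr : ∫ x in Ω, lpPair p (w x) (embedL1 h Ω (c • u) x)
      = ∫ x in Ω, lpPair p (w x) (c * g x) := by
    refine integral_congr_ae ?_
    filter_upwards [hsmul] with x hx
    rw [hx]
  rw [hcongr, norm_smul, Real.norm_of_nonneg hc0.le, Real.mul_rpow hc0.le (norm_nonneg _)] at hK
  have hnonneg : 0 ≤ᵐ[volume.restrict Ω]
      fun x => p / c ^ p * (lpPair p (w x) (c * g x) - w x) := ae_of_all _ fun x =>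
    mul_nonneg (by positivity) (sub_nonneg.2 ((le_abs_self _).trans (abs_le_lpPair hp0 _ _)))
  have hi : Integrable (fun x => p / c ^ p * (lpPair p (w x) (c * g x) - w x))
      (volume.restrict Ω) := (hσi.sub hwi).const_mul _
  refine (lintegral_mono_ae hpt).trans ?_
  rw [← ofReal_integral_eq_lintegral_ofReal hi hnonneg]
  refine ENNReal.ofReal_le_ofReal ?_
  rw [integral_const_mul, integral_sub hσi hwi]
  calc p / c ^ p * ((∫ x in Ω, lpPair p (w x) (c * g x)) - ∫ x in Ω, w x)
      ≤ p / c ^ p * (1 / p * (c ^ p * ‖u‖ ^ p)) := by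
        gcongr
        linarith
    _ = ‖u‖ ^ p := by field_simp

end LpCombination

end FracTorsion

theorem proposition4p1 {N : ℕ} {s p : ℝ} (h : FracTorsion.Exponents s p)
    {Ω : Set (FracTorsion.Space N)} (hΩ : IsOpen Ω) (hc : FracTorsion.CompactlyEmbedsL1 h Ω)
    (u : FracTorsion.HomSobolev h Ω) :
    ∫⁻ x in Ω, ENNReal.ofReal |FracTorsion.toFunction u x| ^ p /
        ENNReal.ofReal (FracTorsion.toFunction (FracTorsion.torsionFunction h Ω) x) ^ (p - 1)
      ≤ FracTorsion.gagliardoEnergy s p (FracTorsion.toFunction u) := by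
  have hp := h.one_lt_p
  have hp0 : 0 < p := by linarith
  refine le_trans ?_ (FracTorsion.ofReal_norm_rpow_le_gagliardoEnergy hΩ hc u)
  set w := FracTorsion.embedL1 h Ω (FracTorsion.torsionFunction h Ω) with hw
  set g := FracTorsion.embedL1 h Ω u with hg
  have hgm : AEMeasurable g (volume.restrict Ω) := (Lp.aestronglyMeasurable g).aemeasurable
  set F : ℕ → FracTorsion.Space N → ℝ≥0∞ := fun n x => ENNReal.ofReal |g x| ^ p /
    ENNReal.ofReal (FracTorsion.lpPair p (w x) (1 / ((n : ℝ) + 1) * g x)) ^ (p - 1) with hF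
  -- As `c = 1 / (n + 1)` tends to `0`, the weight decreases to `|w| = w`. Division in `[0, ∞]` is
  -- continuous in the denominator, also where `w` vanishes.
  have hlim : ∀ᵐ x ∂volume.restrict Ω, Tendsto (fun n => F n x) atTop
      (𝓝 (ENNReal.ofReal |FracTorsion.toFunction u x| ^ p /
        ENNReal.ofReal (FracTorsion.toFunction (FracTorsion.torsionFunction h Ω) x)
          ^ (p - 1))) := by
    filter_upwards [FracTorsion.toFunction_ae_eq hΩ u,
      FracTorsion.toFunction_ae_eq hΩ (FracTorsion.torsionFunction h Ω),
      FracTorsion.torsionFunction_nonneg_ae hΩ hc] with x h1 h2 h3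
    rw [h1, h2]
    have hσ : Tendsto (fun n : ℕ => FracTorsion.lpPair p (w x) (1 / ((n : ℝ) + 1) * g x)) atTop
        (𝓝 (w x)) := by
      have h4 : FracTorsion.lpPair p (w x) (0 * g x) = w x := by
        rw [zero_mul, FracTorsion.lpPair_zero_right hp0, abs_of_nonneg h3]
      have h5 : Continuous fun c : ℝ => FracTorsion.lpPair p (w x) (c * g x) :=
        (FracTorsion.continuous_lpPair hp0).comp
          (continuous_const.prodMk (continuous_id.mul continuous_const))
      have h6 := (h5.tendsto 0).comp (tendsto_one_div_add_atTop_nhds_zero_nat (𝕜 := ℝ))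
      rwa [h4] at h6
    refine ENNReal.Tendsto.const_div ?_ (Or.inr ?_)
    · exact (ENNReal.continuous_rpow_const.tendsto _).comp
        ((ENNReal.continuous_ofReal.tendsto _).comp hσ)
    · exact ENNReal.rpow_ne_top_of_nonneg hp0.le ENNReal.ofReal_ne_top
  have hFm : ∀ n, AEMeasurable (F n) (volume.restrict Ω) := by
    intro n
    have h1 : AEMeasurable (fun x => FracTorsion.lpPair p (w x) (1 / ((n : ℝ) + 1) * g x))
        (volume.restrict Ω) :=
      (Continuous.comp_aestronglyMeasurable₂ (g := FracTorsion.lpPair p)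
        (FracTorsion.continuous_lpPair hp0) (Lp.aestronglyMeasurable w)
        ((Lp.aestronglyMeasurable g).const_mul _)).aemeasurable
    exact (hgm.abs.ennreal_ofReal.pow_const p).div (h1.ennreal_ofReal.pow_const (p - 1))
  calc ∫⁻ x in Ω, ENNReal.ofReal |FracTorsion.toFunction u x| ^ p /
        ENNReal.ofReal (FracTorsion.toFunction (FracTorsion.torsionFunction h Ω) x) ^ (p - 1)
      = ∫⁻ x in Ω, liminf (fun n => F n x) atTop := by
        refine lintegral_congr_ae ?_
        filter_upwards [hlim] with x hx
        exact hx.liminf_eq.symm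
    _ ≤ liminf (fun n => ∫⁻ x in Ω, F n x) atTop := lintegral_liminf_le' hFm
    _ ≤ ENNReal.ofReal (‖u‖ ^ p) := by
        refine liminf_le_of_le (by isBoundedDefault) fun b hb => ?_
        obtain ⟨n, hn⟩ := hb.exists
        exact hn.trans (FracTorsion.lintegral_div_lpPair_le hΩ hc u (by positivity))
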